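/- Setting. There are $n\ge 1$ source arms $S_1,\dots,S_n$, probability distributions on $\mathbb R$ with means $\mu_i$ that are $\sigma$-sub-Gaussian: $\mathbb E_{X\sim S_i}[e^{\lambda(X-\mu_i)}]\le e^{\lambda^2\sigma^2/2}$ for all $\lambda\in\mathbb R$. All samples are independent. Let $\mathcal C_1,\dots,\mathcal C_n\subseteq\mathbb R$. The target arms of the property-testing problem are the sets $M\subseteq\{1,\dots,n\}$, with means $\sum_{i\in M}\mathbb I_{\mathcal C_i}(\mu_i)$, where $\mathbb I_{\mathcal C}(m)=1$ if $m\in \mathcal C$ and $-\infty$ otherwise. Put $f_{M,i}=\mathbb I_{\mathcal C_i}$ if $i\in M$ and $f_{M,i}=0$ if $i\notin M$, and assume that every $f_{M,i}$ is continuous at $\mu_i$ (that is, $\mu_i$ is not a boundary point of $\mathcal C_i$). Let $\delta\in(0,1)$. Algorithm (T-LUCB with $\varepsilon=0$ and width function $\beta$). Sample every source arm once. Let $N_i(t)$ and $\hat\mu_t(i)$ be the number and the average of the samples of arm $i$ available at the start of round $t$; put $L_0(i)=-\infty$, $U_0(i)=+\infty$ and, for $t\ge1$, $$U_t(i)=\min\{U_{t-1}(i),\hat\mu_t(i)+\beta(N_i(t),\tfrac{\delta}{2n})\},\qquad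 L_t(i)=\max\{L_{t-1}(i),\hat\mu_t(i)-\beta(N_i(t),\tfrac{\delta}{2n})\}.$$ The target confidence bounds are $L_t(M)=\sum_i\min_{m\in[L_t(i),U_t(i)]}f_{M,i}(m)$ and $U_t(M)=\sum_i\max_{m\in[L_t(i),U_t(i)]}f_{M,i}(m)$. In round $t=1,2,\dots$ let $B_t$ maximize $L_t(M)$ over all $M$, and let $C_t$ maximize $U_t(M)$ over $M\ne B_t$. Stop if $L_t(B_t)\ge U_t(C_t)$; otherwise draw one sample from each of the source arms $I_t$ and $J_t$ that contribute most to the lengths of the confidence intervals of $B_t$ and of $C_t$, that is, which maximize $\max f_{M,i}-\min f_{M,i}$ over $[L_t(i),U_t(i)]$ for $M=B_t$ and $M=C_t$ respectively (with $\infty-\infty=0$). Ties are broken arbitrarily. Let $\tau\in\{1,2,\dots\}\cup\{\infty\}$ be the round in which the algorithm stops. Put $$H=\sum_{i=1}^n\frac{2}{\Delta_{\mathcal C_i}(\mu_i)^2},\qquad \Delta_{\mathcal C}(m)=\begin{cases}\inf_{x\notin \mathcal C}|x-m|& m\in \mathcal C,\\ \inf_{x\in \mathcal C}|x-m|& m\notin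 \mathcal C\end{cases}$$ (with $\inf\emptyset=\infty$ and $2/\infty=0$), and, for a constant $K$, $$T_K(H)=1+K\sigma^2H\Big(\log\tfrac1\delta+\log(2n)+\log\log\big(e+\max\{1,\sigma^2\}\,\sigma^2H\big)\Big).$$ (i) There is a universal constant $K>0$ such that, for $\sigma\ge1$ and the polynomial stitched boundary $$\beta(t,\alpha)=1.7\sqrt{\frac{\sigma^2\left(\log\log(2t\sigma^2)+0.72\log\frac{5.2}{\alpha}\right)}{t}},$$ one has $\tau\le T_K(H)$ with probability at least $1-\delta$. (ii) In particular, for thresholding bandits, where $\mathcal C_i=(\theta,\infty)$ for all $i$ with $\mu_i\ne\theta$, there is a universal constant $K>0$ such that, for $\sigma\ge1$ and the same $\beta$, $\tau\le T_K\big(\sum_i 2/(\mu_i-\theta)^2\big)$ with probability at least $1-\delta$. (iii) For every $c>0$ there is $K>0$ depending only on $c$ such that the following holds for every $\sigma>0$ and every $\beta$ with $\beta(s,\tfrac\delta{2n})\le c\sqrt{\sigma^2\big(\log\log(e+s\max\{1,\sigma^2\})+\log\tfrac{2n}{\delta}\big)/s}$ for all $s\ge1$: if the confidence sequences have coverage,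 $\mathbb P\{\exists t\ge1\ \exists i:\ \mu_i\notin[L_t(i),U_t(i)]\}\le\delta$, then $\tau\le T_K(H)$ with probability at least $1-\delta$. -/

import Mathlib

open MeasureTheory ProbabilityTheory

open scoped ENNReal

noncomputable section

/-! ## Best arm identification with an additive transfer function

There are `n` source arms, which can be sampled, and finitely many target arms `a : A`, which
cannot.  The mean of target arm `a` is `∑ i, f a i (μ i)`, with `f a i : ℝ → EReal` known and
`μ i` the unknown mean of source arm `i`. -/

namespace TLUCB

variable {n : ℕ} {A : Type*}

/-- One trajectory of the choices of the algorithm.  In round `t ≥ 1` the target arms `B t`, `C t`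
are compared and the source arms `I t`, `J t` are sampled. -/
structure Run (A : Type*) (n : ℕ) where
  B : ℕ → A
  C : ℕ → A
  I : ℕ → Fin n
  J : ℕ → Fin n

/-- Number of samples of source arm `i` available at the beginning of round `t ≥ 1`: one from the
initialization, and those of the rounds `1, …, t - 1`. -/
def pulls (R : Run A n) (i : Fin n) (t : ℕ) : ℕ :=
  1 + ∑ s ∈ Finset.Ico 1 t, ((if R.I s = i then 1 else 0) + (if R.J s = i then 1 else 0))

/-- Empirical mean of source arm `i` at the beginning of round `t`, where `x i k` is the `k`-th
sample (from `0`) drawn from arm `i`. -/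
def empMean (x : Fin n → ℕ → ℝ) (R : Run A n) (i : Fin n) (t : ℕ) : ℝ :=
  (∑ k ∈ Finset.range (pulls R i t), x i k) / (pulls R i t : ℝ)

/-- Lower confidence bound of a source arm (running maximum). -/
def srcLCB (β : ℕ → ℝ → ℝ) (δ : ℝ) (x : Fin n → ℕ → ℝ) (R : Run A n) (i : Fin n) : ℕ → EReal
  | 0 => ⊥
  | t + 1 => max (srcLCB β δ x R i t)
      ((empMean x R i (t + 1) - β (pulls R i (t + 1)) (δ / (2 * n)) : ℝ) : EReal)

/-- Upper confidence bound of a source arm (running minimum). -/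
def srcUCB (β : ℕ → ℝ → ℝ) (δ : ℝ) (x : Fin n → ℕ → ℝ) (R : Run A n) (i : Fin n) : ℕ → EReal
  | 0 => ⊤
  | t + 1 => min (srcUCB β δ x R i t)
      ((empMean x R i (t + 1) + β (pulls R i (t + 1)) (δ / (2 * n)) : ℝ) : EReal)

/-- Confidence interval of a source arm in round `t`. -/
def srcCI (β : ℕ → ℝ → ℝ) (δ : ℝ) (x : Fin n → ℕ → ℝ) (R : Run A n) (i : Fin n) (t : ℕ) :
    Set ℝ :=
  {m | srcLCB β δ x R i t ≤ (m : EReal) ∧ (m : EReal) ≤ srcUCB β δ x R i t}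

/-- Lower confidence bound of target arm `a` in round `t`. -/
def tgtLCB (f : A → Fin n → ℝ → EReal) (β : ℕ → ℝ → ℝ) (δ : ℝ) (x : Fin n → ℕ → ℝ)
    (R : Run A n) (a : A) (t : ℕ) : EReal :=
  ∑ i, ⨅ m ∈ srcCI β δ x R i t, f a i m

/-- Upper confidence bound of target arm `a` in round `t`. -/
def tgtUCB (f : A → Fin n → ℝ → EReal) (β : ℕ → ℝ → ℝ) (δ : ℝ) (x : Fin n → ℕ → ℝ)
    (R : Run A n) (a : A) (t : ℕ) : EReal :=
  ∑ i, ⨆ m ∈ srcCI β δ x R i t, f a i m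

open Classical in
/-- Subtraction of extended reals with the convention `∞ - ∞ = 0` (also for `-∞`). -/
def extSub (a b : EReal) : EReal := if a = b then 0 else a - b

/-- Contribution of source arm `i` to the length of the confidence interval of target arm `a`. -/
def len (f : A → Fin n → ℝ → EReal) (β : ℕ → ℝ → ℝ) (δ : ℝ) (x : Fin n → ℕ → ℝ)
    (R : Run A n) (i : Fin n) (a : A) (t : ℕ) : EReal :=
  extSub (⨆ m ∈ srcCI β δ x R i t, f a i m) (⨅ m ∈ srcCI β δ x R i t, f a i m)

/-- `R` follows the sampling rule of T-LUCB on the samples `x`.  Ties in the maximizations are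
broken arbitrarily.  (The rounds after the stopping time play no role.) -/
structure IsRun (f : A → Fin n → ℝ → EReal) (β : ℕ → ℝ → ℝ) (δ : ℝ) (x : Fin n → ℕ → ℝ)
    (R : Run A n) : Prop where
  argmax_B : ∀ t, 1 ≤ t → ∀ a, tgtLCB f β δ x R a t ≤ tgtLCB f β δ x R (R.B t) t
  C_ne_B : ∀ t, 1 ≤ t → R.C t ≠ R.B t
  argmax_C : ∀ t, 1 ≤ t → ∀ a, a ≠ R.B t → tgtUCB f β δ x R a t ≤ tgtUCB f β δ x R (R.C t) t
  argmax_I : ∀ t, 1 ≤ t → ∀ i, len f β δ x R i (R.B t) t ≤ len f β δ x R (R.I t) (R.B t) t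
  argmax_J : ∀ t, 1 ≤ t → ∀ i, len f β δ x R i (R.C t) t ≤ len f β δ x R (R.J t) (R.C t) t

/-- The stopping condition in round `t`. -/
def Stops (f : A → Fin n → ℝ → EReal) (β : ℕ → ℝ → ℝ) (ε δ : ℝ) (x : Fin n → ℕ → ℝ)
    (R : Run A n) (t : ℕ) : Prop :=
  tgtUCB f β δ x R (R.C t) t ≤ tgtLCB f β δ x R (R.B t) t + (ε : EReal)

/-- The stopping time: the first round `t ≥ 1` in which the stopping condition holds, `⊤` if
there is none. -/
def stoppingTime (f : A → Fin n → ℝ → EReal) (β : ℕ → ℝ → ℝ) (ε δ : ℝ) (x : Fin n → ℕ → ℝ)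
    (R : Run A n) : ℕ∞ :=
  ⨅ (t : ℕ) (_ : 1 ≤ t ∧ Stops f β ε δ x R t), (t : ℕ∞)

/-- The polynomial stitched boundary. -/
def stitched (σ : ℝ) (t : ℕ) (α : ℝ) : ℝ :=
  1.7 * √(σ ^ 2 * (Real.log (Real.log (2 * t * σ ^ 2)) + 0.72 * Real.log (5.2 / α)) / t)

/-! ### The source bandit -/

/-- Mean of a source arm. -/
def armMean (S : Fin n → Measure ℝ) (i : Fin n) : ℝ := ∫ y, y ∂(S i)

/-- The source arms are probability distributions and, centred, `σ`-sub-Gaussian. -/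
structure IsSubGaussianBandit (S : Fin n → Measure ℝ) (σ : ℝ) : Prop where
  prob : ∀ i, IsProbabilityMeasure (S i)
  subGaussian : ∀ i, HasSubgaussianMGF (fun y => y - armMean S i) (Real.toNNReal (σ ^ 2)) (S i)

/-- `Y i k`, the `k`-th sample drawn from source arm `i`, has law `S i`, and all samples are
independent. -/
structure IsSampling {Ω : Type*} [MeasurableSpace Ω] (S : Fin n → Measure ℝ) (P : Measure Ω)
    (Y : Fin n → ℕ → Ω → ℝ) : Prop where
  measurable : ∀ i k, Measurable (Y i k)
  law : ∀ i k, P.map (Y i k) = S i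
  indep : iIndepFun (fun p : Fin n × ℕ => Y p.1 p.2) P

/-! ### Property testing -/

open Classical in
/-- `1` on `A`, and `-∞` off `A`. -/
def propInd (A : Set ℝ) (m : ℝ) : EReal := if m ∈ A then 1 else ⊥

/-- Transfer function of property testing: the target arms are the sets `M` of source arms, and
the mean of `M` is `∑ i ∈ M, propInd (A i) (μ i)`. -/
def propTransfer (A : Fin n → Set ℝ) (M : Finset (Fin n)) (i : Fin n) (m : ℝ) : EReal :=
  if i ∈ M then propInd (A i) m else 0

open Classical in
/-- Distance of `m` to the complement of `A` if `m ∈ A`, and to `A` if `m ∉ A`; it is `⊤` if the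
set in question is empty. -/
def gap (A : Set ℝ) (m : ℝ) : ℝ≥0∞ :=
  if m ∈ A then Metric.infEDist m Aᶜ else Metric.infEDist m A

/-- The complexity `H = ∑ i, 2 / (gap of arm i)²`. -/
def complexity (A : Fin n → Set ℝ) (μ : Fin n → ℝ) : ℝ≥0∞ := ∑ i, 2 / gap (A i) (μ i) ^ 2

/-- The explicit form of `Õ(H log (1/δ))`: constant `K`, and iterated logarithm of `H`. -/
def timeBound (K : ℝ) (n : ℕ) (σ δ H : ℝ) : ℝ :=
  1 + K * σ ^ 2 * H * (Real.log (1 / δ) + Real.log (2 * n)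
    + Real.log (Real.log (Real.exp 1 + max 1 (σ ^ 2) * σ ^ 2 * H)))

end TLUCB

end

/-!
The proof separates a statement about single trajectories from one about probabilities.

*Trajectories.* Suppose that all confidence intervals contain the means. The transfer function of
property testing is locally constant off the boundary of the property, so a source arm contributes
to the interval of a target arm only while its width `2 * β N` is at least the gap `Δ`. If `J t` does
not contribute to the challenger `C t`, then the interval of `C t` is a point and the algorithm
stops. Hence every earlier round can be charged to an arm `J t` with `Δ ≤ 2 * β N`, and each round
increases the number `N` of samples of the arm it is charged to: the number of rounds is at most the
sum over the arms of the largest `N` with `Δ ≤ 2 * β N` (`TLUCB.stoppingTime_le_of_coverage`). With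
`β N` of order `√(σ² (log log N + D) / N)` this inequality is inverted to
`N ≤ K * σ² / Δ² * (D + log log H)` (`TLUCB.exists_loglog_inversion`). Together these give
`TLUCB.exists_stoppingTime_le_timeBound`, from which the part about a general width function follows
at once.

*Coverage.* For the stitched boundary, the probability that some interval misses its mean is bounded
by stitching (`TLUCB.measure_exists_stitched_lt_le`). In each epoch
`2 ^ k ≤ m * σ ^ 2 < 2 ^ (k + 1)` the boundary lies above a line, which a sub-Gaussian sum crosses
with probability at most `exp (-x)`, by Ville's inequality for the exponential martingale
(`TLUCB.measure_exists_line_crossing_le`). The levels `x` are `7/5 * log (k + 1)` up to a constant,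
so the sum over the epochs is governed by `ζ(7/5)`.

Thresholding bandits are the case in which all properties are the half-line `(θ, ∞)`.
-/

namespace TLUCB

/-! ### A maximal inequality for sums of sub-Gaussian variables -/

section Ville

variable {Ω : Type*} [MeasurableSpace Ω] {P : Measure Ω}

theorem martingale_prod_of_iIndepFun [IsProbabilityMeasure P] {Z : ℕ → Ω → ℝ}
    (hZm : ∀ k, StronglyMeasurable (Z k)) (hZ : iIndepFun Z P) (hint : ∀ k, Integrable (Z k) P)
    (hone : ∀ k, ∫ ω, Z k ω ∂P = 1) :
    Martingale (fun m => ∏ k ∈ Finset.range (m + 1), Z k) (Filtration.natural Z hZm) P := by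
  have hmeas : StronglyAdapted (Filtration.natural Z hZm)
      (fun m => ∏ k ∈ Finset.range (m + 1), Z k) := fun m =>
    Finset.stronglyMeasurable_prod _ fun k hk =>
      (Filtration.stronglyAdapted_natural hZm k).mono
        ((Filtration.natural Z hZm).mono (Nat.lt_succ_iff.mp (Finset.mem_range.mp hk)))
  have hprod : ∀ m, Integrable (∏ k ∈ Finset.range (m + 1), Z k) P := by
    intro m
    induction m with
    | zero => simpa using hint 0
    | succ m ih =>
      rw [Finset.prod_range_succ]
      exact (hZ.indepFun_prod_range_succ (fun k => (hZm k).measurable) (m + 1)).integrable_mul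
        ih (hint _)
  refine martingale_nat hmeas hprod fun m => ?_
  have hnext : P[Z (m + 1) | Filtration.natural Z hZm m] =ᵐ[P] fun _ => 1 := by
    have := hZ.condExp_natural_ae_eq_of_lt hZm (Nat.lt_succ_self m)
    rwa [hone] at this
  have hpull : P[(∏ k ∈ Finset.range (m + 1), Z k) * Z (m + 1) | Filtration.natural Z hZm m]
      =ᵐ[P] (∏ k ∈ Finset.range (m + 1), Z k) * P[Z (m + 1) | Filtration.natural Z hZm m] := by
    refine condExp_mul_of_stronglyMeasurable_left (hmeas m) ?_ (hint _)
    rw [← Finset.prod_range_succ]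
    exact hprod (m + 1)
  rw [Finset.prod_range_succ _ (m + 1)]
  filter_upwards [hnext, hpull] with ω h1 h2
  rw [h2, Pi.mul_apply, h1, mul_one]

/-- Ville's inequality for a nonnegative martingale with initial mean `1`: Doob's maximal inequality
up to a finite horizon, which is then sent to infinity. -/
theorem measure_exists_le_of_martingale [IsProbabilityMeasure P] {F : Filtration ℕ ‹_›}
    {M : ℕ → Ω → ℝ} (hM : Martingale M F P) (hnonneg : ∀ m ω, 0 ≤ M m ω)
    (hone : ∫ ω, M 0 ω ∂P = 1) {a : ℝ} (ha : 0 < a) :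
    P {ω | ∃ m, a ≤ M m ω} ≤ ENNReal.ofReal a⁻¹ := by
  have hunion : {ω | ∃ m, a ≤ M m ω} =
      ⋃ N : ℕ, {ω | a ≤ (Finset.range (N + 1)).sup' Finset.nonempty_range_add_one
        fun k => M k ω} := by
    ext ω
    simp only [Set.mem_ofPred_eq, Set.mem_iUnion, Finset.le_sup'_iff, Finset.mem_range]
    exact ⟨fun ⟨m, hm⟩ => ⟨m, m, Nat.lt_succ_self m, hm⟩, fun ⟨_, m, _, hm⟩ => ⟨m, hm⟩⟩
  have hmono : Monotone fun N : ℕ => {ω | a ≤ (Finset.range (N + 1)).sup'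
      Finset.nonempty_range_add_one fun k => M k ω} := by
    intro N N' h ω hω
    simp only [Set.mem_ofPred_eq, Finset.le_sup'_iff, Finset.mem_range] at hω ⊢
    obtain ⟨m, hm, hle⟩ := hω
    exact ⟨m, by omega, hle⟩
  rw [hunion, hmono.measure_iUnion]
  refine iSup_le fun N => ?_
  have hdoob := maximal_ineq hM.submartingale (fun m ω => hnonneg m ω) (ε := a.toNNReal) N
  rw [Real.coe_toNNReal a ha.le] at hdoob
  have hint : ∫ ω, M N ω ∂P = 1 := by
    have := hM.setIntegral_eq (Nat.zero_le N) (s := Set.univ) MeasurableSet.univ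
    simp only [setIntegral_univ] at this
    rw [← this, hone]
  have hle := hdoob.trans (ENNReal.ofReal_le_ofReal (setIntegral_le_integral (hM.integrable N)
    (Filter.Eventually.of_forall (hnonneg N))))
  rw [hint, ENNReal.ofReal_one] at hle
  rw [ENNReal.ofReal_inv_of_pos ha, ENNReal.le_inv_iff_mul_le, mul_comm]
  exact hle

/-- The sums of independent `c`-sub-Gaussian variables cross a line of slope `c * l / 2` with
exponentially small probability. The sign of `l` is arbitrary. The variables `exp (l * X k)` are
divided by their means, not by the bound on these, so that their products form a martingale; the
sub-Gaussian bound then enters pointwise. -/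
theorem measure_exists_line_crossing_le [IsProbabilityMeasure P] {X : ℕ → Ω → ℝ} {c : NNReal}
    (hXm : ∀ k, Measurable (X k)) (hX : iIndepFun X P) (hsub : ∀ k, HasSubgaussianMGF (X k) c P)
    (l x : ℝ) :
    P {ω | ∃ m : ℕ, 1 ≤ m ∧ x + m * (c * l ^ 2 / 2) ≤ l * ∑ k ∈ Finset.range m, X k ω}
      ≤ ENNReal.ofReal (Real.exp (-x)) := by
  have hpos : ∀ k, 0 < mgf (X k) P l := fun k => mgf_pos ((hsub k).integrable_exp_mul l)
  set Z : ℕ → Ω → ℝ := fun k ω => Real.exp (l * X k ω) / mgf (X k) P l with hZdef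
  have hZm : ∀ k, StronglyMeasurable (Z k) := fun k =>
    (((hXm k).const_mul l).exp.div_const _).stronglyMeasurable
  have hZ : iIndepFun Z P :=
    hX.comp (fun k y => Real.exp (l * y) / mgf (X k) P l) fun k => by fun_prop
  have hint : ∀ k, Integrable (Z k) P := fun k => ((hsub k).integrable_exp_mul l).div_const _
  have hone : ∀ k, ∫ ω, Z k ω ∂P = 1 := fun k => by
    simp only [hZdef, integral_div]
    exact div_self (hpos k).ne'
  have hmart := martingale_prod_of_iIndepFun hZm hZ hint hone
  have hville := measure_exists_le_of_martingale hmart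
    (fun m ω => by
      rw [Finset.prod_apply]
      exact Finset.prod_nonneg fun k _ => div_nonneg (Real.exp_pos _).le (hpos k).le)
    (by simpa using hone 0) (Real.exp_pos x)
  rw [← Real.exp_neg] at hville
  refine (measure_mono ?_).trans hville
  rintro ω ⟨m, hm, hle⟩
  obtain ⟨m, rfl⟩ : ∃ j, m = j + 1 := ⟨m - 1, by omega⟩
  refine ⟨m, ?_⟩
  have hstep : ∀ k ∈ Finset.range (m + 1),
      Real.exp (l * X k ω - c * l ^ 2 / 2) ≤ Z k ω := fun k _ => by
    rw [Real.exp_sub]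
    exact div_le_div_of_nonneg_left (Real.exp_pos _).le (hpos k) ((hsub k).mgf_le l)
  rw [Finset.prod_apply]
  -- Each factor is at least `exp (l * X k - c * l ^ 2 / 2)`.
  refine le_trans ?_ (Finset.prod_le_prod (fun k _ => (Real.exp_pos _).le) hstep)
  rw [← Real.exp_sum, Real.exp_le_exp, Finset.sum_sub_distrib, ← Finset.mul_sum,
    Finset.sum_const, Finset.card_range, nsmul_eq_mul]
  linarith

end Ville

/-! ### The stitched boundary -/

section Stitching

/-- A lower bound for the increment of `exp` by the derivative at the midpoint. -/
theorem exp_midpoint_mul_le {y z : ℝ} (h : z ≤ y) :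
    Real.exp ((y + z) / 2) * (y - z) ≤ Real.exp y - Real.exp z := by
  have hs : (y - z) / 2 ≤ Real.sinh ((y - z) / 2) := Real.self_le_sinh_iff.mpr (by linarith)
  rw [Real.sinh_eq] at hs
  have h1 : Real.exp y = Real.exp ((y + z) / 2) * Real.exp ((y - z) / 2) := by
    rw [← Real.exp_add]; ring_nf
  have h2 : Real.exp z = Real.exp ((y + z) / 2) * Real.exp (-((y - z) / 2)) := by
    rw [← Real.exp_add]; ring_nf
  rw [h1, h2, ← mul_sub]
  exact mul_le_mul_of_nonneg_left (by linarith) (Real.exp_pos _).le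

/-- Midpoint bound `(k + 1) ^ (-7/5) ≤ ∫ x in k + 1/2..k + 3/2, x ^ (-7/5)` in integrated form. The
cruder bound by the integral over `[k, k + 1]` would lose too much for `sum_rpow_neg_le`. -/
theorem rpow_neg_le_sub_rpow (k : ℕ) :
    ((k : ℝ) + 1) ^ (-(7 / 5) : ℝ) ≤
      5 / 2 * ((k : ℝ) + 1 / 2) ^ (-(2 / 5) : ℝ)
        - 5 / 2 * (((k + 1 : ℕ) : ℝ) + 1 / 2) ^ (-(2 / 5) : ℝ) := by
  have hk : (0 : ℝ) ≤ k := k.cast_nonneg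
  set a : ℝ := k + 1 / 2 with ha
  have ha0 : 0 < a := by positivity
  have hb : ((k + 1 : ℕ) : ℝ) + 1 / 2 = a + 1 := by push_cast; ring
  have hc : (k : ℝ) + 1 = a + 1 / 2 := by rw [ha]; ring
  rw [hb, hc]
  have hlog : 1 / (a + 1 / 2) ≤ Real.log (a + 1) - Real.log a := by
    have h := Real.le_log_one_add_of_nonneg (x := 1 / a) (by positivity)
    have h1 : 1 + 1 / a = (a + 1) / a := by field_simp
    rw [h1, Real.log_div (by positivity) (by positivity)] at h
    refine le_trans (le_of_eq ?_) h
    field_simp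
    ring
  have hmid : (Real.log a + Real.log (a + 1)) / 2 ≤ Real.log (a + 1 / 2) := by
    have h : Real.log (a * (a + 1)) ≤ Real.log ((a + 1 / 2) ^ 2) :=
      Real.log_le_log (by positivity) (by nlinarith)
    rw [Real.log_mul (by positivity) (by positivity), Real.log_pow] at h
    push_cast at h
    linarith
  have hlog0 : 0 ≤ Real.log (a + 1) - Real.log a := le_trans (by positivity) hlog
  have hdiff := exp_midpoint_mul_le (y := Real.log a * (-(2 / 5)))
    (z := Real.log (a + 1) * (-(2 / 5))) (by linarith)
  rw [Real.rpow_def_of_pos ha0, Real.rpow_def_of_pos (by positivity : (0 : ℝ) < a + 1)]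
  have hexp : Real.exp (Real.log (a + 1 / 2) * (-(2 / 5))) * (2 / 5 * (1 / (a + 1 / 2))) ≤
      Real.exp ((Real.log a * (-(2 / 5)) + Real.log (a + 1) * (-(2 / 5))) / 2) *
        (Real.log a * (-(2 / 5)) - Real.log (a + 1) * (-(2 / 5))) :=
    mul_le_mul (Real.exp_le_exp.mpr (by linarith)) (by linarith) (by positivity)
      (Real.exp_pos _).le
  have hpow : (a + 1 / 2) ^ (-(7 / 5) : ℝ) =
      Real.exp (Real.log (a + 1 / 2) * (-(2 / 5))) * (1 / (a + 1 / 2)) := by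
    rw [← Real.rpow_def_of_pos (by positivity), one_div (a + 1 / 2),
      ← Real.rpow_neg_one (a + 1 / 2), ← Real.rpow_add (by positivity)]
    norm_num
  rw [hpow]
  linarith

/-- An upper bound for `ζ(7/5) = 3.105…`: the first term is kept, the others are bounded by the
integral of `x ^ (-7/5)` over `[3/2, ∞)`. -/
theorem sum_rpow_neg_le (N : ℕ) :
    ∑ k ∈ Finset.range N, ((k : ℝ) + 1) ^ (-(7 / 5) : ℝ) ≤ 3.15 := by
  have htail : ∀ N : ℕ, ∑ k ∈ Finset.range (N + 1), ((k : ℝ) + 1) ^ (-(7 / 5) : ℝ) ≤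
      1 + 5 / 2 * (3 / 2 : ℝ) ^ (-(2 / 5) : ℝ)
        - 5 / 2 * (((N + 1 : ℕ) : ℝ) + 1 / 2) ^ (-(2 / 5) : ℝ) := by
    intro N
    induction N with
    | zero => norm_num
    | succ N ih =>
      rw [Finset.sum_range_succ]
      linarith [rpow_neg_le_sub_rpow (N + 1)]
  have hnum : (3 / 2 : ℝ) ^ (-(2 / 5) : ℝ) ≤ 0.86 := by
    refine le_of_pow_le_pow_left₀ (n := 5) (by norm_num) (by norm_num) ?_
    rw [← Real.rpow_natCast, ← Real.rpow_mul (by norm_num)]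
    norm_num
  have h := htail N
  have hpos : 0 ≤ (((N + 1 : ℕ) : ℝ) + 1 / 2) ^ (-(2 / 5) : ℝ) := by positivity
  refine (Finset.sum_le_sum_of_subset_of_nonneg
    (Finset.range_mono (Nat.le_succ N)) fun k _ _ => by positivity).trans (h.trans ?_)
  linarith

/-- The exponent `x` for which the epoch `2 ^ k ≤ m * σ ^ 2 < 2 ^ (k + 1)` is allotted the error
probability `exp (-x)`. Up to a factor this probability is `(k + 1) ^ (-7/5) * α`; the logarithm of
`log 2` appears since the boundary is written in terms of `log (2 * v) ≥ (k + 1) * log 2`. The last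
summand `0.02` makes up for the estimate `3.15` of `ζ(7/5)`. -/
noncomputable def epochLevel (α : ℝ) (k : ℕ) : ℝ :=
  7 / 5 * (Real.log (k + 1) + Real.log (Real.log 2)) + Real.log (5.2 / α) + 0.02

/-- This is where the constant `5.2` of the boundary is used: `ζ(7/5) * (log 2) ^ (-7/5) ≈ 5.19`. -/
theorem tsum_exp_neg_epochLevel_le {α : ℝ} (hα : 0 < α) :
    ∑' k, ENNReal.ofReal (Real.exp (-epochLevel α k)) ≤ ENNReal.ofReal α := by
  have hl2 : 0.69314 < Real.log 2 := lt_trans (by norm_num) Real.log_two_gt_d9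
  have hl0 : 0 < Real.log 2 := by linarith
  have hterm : ∀ k : ℕ, Real.exp (-epochLevel α k) =
      ((k : ℝ) + 1) ^ (-(7 / 5) : ℝ) *
        (Real.log 2 ^ (-(7 / 5) : ℝ) * (α / 5.2) * Real.exp (-0.02)) := by
    intro k
    have h1 : Real.exp (-Real.log (5.2 / α)) = α / 5.2 := by
      rw [Real.exp_neg, Real.exp_log (by positivity), inv_div]
    rw [Real.rpow_def_of_pos (by positivity), Real.rpow_def_of_pos hl0, ← h1, ← Real.exp_add,
      ← Real.exp_add, ← Real.exp_add, epochLevel]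
    ring_nf
  have hc1 : Real.log 2 ^ (-(7 / 5) : ℝ) ≤ 1.68 := by
    refine le_of_pow_le_pow_left₀ (n := 5) (by norm_num) (by norm_num) ?_
    rw [← Real.rpow_natCast, ← Real.rpow_mul hl0.le]
    rw [show -(7 / 5) * ((5 : ℕ) : ℝ) = ((-7 : ℤ) : ℝ) by norm_num, Real.rpow_intCast, zpow_neg]
    refine inv_le_of_inv_le₀ (by positivity) ?_
    refine le_trans ?_ (pow_le_pow_left₀ (by norm_num) hl2.le 7)
    norm_num
  have hc2 : Real.exp (-0.02) ≤ 1 / 1.02 := by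
    rw [Real.exp_neg, ← one_div]
    exact one_div_le_one_div_of_le (by norm_num) (by linarith [Real.add_one_le_exp (0.02 : ℝ)])
  have hc : 3.15 * (Real.log 2 ^ (-(7 / 5) : ℝ) * (α / 5.2) * Real.exp (-0.02)) ≤ α := by
    have h2 : Real.log 2 ^ (-(7 / 5) : ℝ) * Real.exp (-0.02) ≤ 1.68 * (1 / 1.02) :=
      mul_le_mul hc1 hc2 (Real.exp_pos _).le (by norm_num)
    have h3 := mul_le_mul_of_nonneg_left h2 hα.le
    norm_num at h3 ⊢
    linarith
  refine ENNReal.tsum_le_of_sum_range_le fun N => ?_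
  rw [← ENNReal.ofReal_sum_of_nonneg fun k _ => (Real.exp_pos _).le]
  refine ENNReal.ofReal_le_ofReal ?_
  simp only [hterm]
  rw [← Finset.sum_mul]
  exact (mul_le_mul_of_nonneg_right (sum_rpow_neg_le N) (by positivity)).trans hc

/-- This is where the constants `1.7` and `0.72` of the boundary are used: `1.7 ^ 2 = 2.89` exceeds
`7/5 * (1 + 3/4 * √2) = 2.884…`, and the small summand of `epochLevel` is paid for by
`2.89 * 0.72 - (1 + 3/4 * √2) > 0.02`, as `log (5.2 / α) ≥ log 10.4`. -/
theorem epochLevel_pos_and_le {α : ℝ} (hα : 0 < α) (hα2 : α ≤ 1 / 2) {k : ℕ} {v : ℝ}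
    (hv : 2 ^ k ≤ v) :
    0 < epochLevel α k ∧ (1 + 3 / 4 * √2) * epochLevel α k ≤
      2.89 * (Real.log (Real.log (2 * v)) + 0.72 * Real.log (5.2 / α)) := by
  have hl2 : 0.6931 < Real.log 2 := lt_trans (by norm_num) Real.log_two_gt_d9
  have hl0 : 0 < Real.log 2 := by linarith
  have hD : 2.3 ≤ Real.log (5.2 / α) := by
    have h1 : Real.log ((2 : ℝ) ^ 3 * 1.3) ≤ Real.log (5.2 / α) := by
      refine Real.log_le_log (by norm_num) ?_
      rw [le_div_iff₀ hα]
      linarith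
    have h2 : 1 - (1.3 : ℝ)⁻¹ ≤ Real.log 1.3 := Real.one_sub_inv_le_log_of_pos (by norm_num)
    rw [Real.log_mul (by norm_num) (by norm_num), Real.log_pow] at h1
    norm_num at h1 h2 ⊢
    linarith
  have hll : -0.45 ≤ Real.log (Real.log 2) := by
    have h := Real.one_sub_inv_le_log_of_pos hl0
    have h3 : (Real.log 2)⁻¹ ≤ (0.6931 : ℝ)⁻¹ := inv_anti₀ (by norm_num) hl2.le
    norm_num at h3 ⊢
    linarith
  have hk : 0 ≤ Real.log ((k : ℝ) + 1) := Real.log_nonneg (by linarith [k.cast_nonneg (α := ℝ)])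
  have hW : Real.log (k + 1) + Real.log (Real.log 2) ≤ Real.log (Real.log (2 * v)) := by
    rw [← Real.log_mul (by positivity) hl0.ne']
    refine Real.log_le_log (by positivity) ?_
    have h := Real.log_le_log (by positivity) (by linarith : (2 : ℝ) * 2 ^ k ≤ 2 * v)
    rw [← pow_succ', Real.log_pow] at h
    exact_mod_cast h
  have hs : √2 ≤ 1.41422 := by
    rw [Real.sqrt_le_left (by norm_num)]
    norm_num
  rw [epochLevel]
  refine ⟨by linarith, ?_⟩
  set Lk := Real.log ((k : ℝ) + 1) + Real.log (Real.log 2)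
  have hLk : -0.45 ≤ Lk := by linarith
  have hx : 0 ≤ 7 / 5 * Lk + Real.log (5.2 / α) + 0.02 := by linarith
  have := mul_le_mul_of_nonneg_right (by linarith : 1 + 3 / 4 * √2 ≤ 2.060665) hx
  linarith

/-- On the epoch `w ≤ v ≤ 2 * w` (where `v = w * r`), the line `x / l + v * l / 2` lies below the
boundary `1.7 * √(v * E)`. The slope is the one for which the line is tangent to the curve
`√(2 * x * v)` at the geometric mean `√2 * w` of the end points. -/
theorem line_le_of_mem_epoch {x r E w l : ℝ} (hx : 0 < x) (hr1 : 1 ≤ r) (hr2 : r ≤ 2)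
    (hw : 0 < w) (hl : l = √(√2 * x / w)) (hE : (1 + 3 / 4 * √2) * x ≤ 2.89 * E) :
    x + w * r * l ^ 2 / 2 ≤ l * (1.7 * √(w * r * E)) := by
  have hs : √2 * √2 = 2 := Real.mul_self_sqrt (by norm_num)
  have hs0 : 0 < √2 := by positivity
  have hE0 : 0 < E := by nlinarith
  have hl2 : l ^ 2 = √2 * x / w := by rw [hl, Real.sq_sqrt (by positivity)]
  have hl0 : 0 ≤ l := by rw [hl]; positivity
  refine le_of_pow_le_pow_left₀ two_ne_zero (by positivity) ?_
  rw [mul_pow, mul_pow, Real.sq_sqrt (by positivity), hl2]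
  have h1 : w * r * (√2 * x / w) / 2 = r * √2 * x / 2 := by field_simp
  have h2 : √2 * x / w * (1.7 ^ 2 * (w * r * E)) = √2 * x * r * (2.89 * E) := by
    field_simp; norm_num
  rw [h1, h2]
  have h3 : √2 * x * r * ((1 + 3 / 4 * √2) * x) ≤ √2 * x * r * (2.89 * E) :=
    mul_le_mul_of_nonneg_left hE (by positivity)
  refine le_trans ?_ h3
  -- The inequality between the squares amounts to `(r - 1) * (2 - r) ≥ 0`.
  have h4 : √2 * x * r * ((1 + 3 / 4 * √2) * x) - (x + r * √2 * x / 2) ^ 2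
      = x ^ 2 * ((r - 1) * (2 - r)) / 2 := by
    linear_combination (3 / 4 * x ^ 2 * r - x ^ 2 * r ^ 2 / 4) * hs
  nlinarith [mul_nonneg (sq_nonneg x) (mul_nonneg (sub_nonneg.mpr hr1) (sub_nonneg.mpr hr2))]

theorem mul_stitched {σ α : ℝ} {m : ℕ} (hm : 1 ≤ m) :
    m * stitched σ m α = 1.7 * √(m * σ ^ 2 *
      (Real.log (Real.log (2 * (m * σ ^ 2))) + 0.72 * Real.log (5.2 / α))) := by
  have hm0 : (0 : ℝ) < m := by exact_mod_cast hm
  rw [stitched, mul_left_comm]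
  congr 1
  nth_rewrite 1 [← Real.sqrt_sq hm0.le]
  rw [← Real.sqrt_mul (sq_nonneg _)]
  congr 1
  rw [← mul_assoc 2]
  field_simp

/-- One-sided coverage of the polynomial stitched boundary: a union bound over the epochs
`2 ^ k ≤ m * σ ^ 2 < 2 ^ (k + 1)`, in each of which the boundary lies above a line. -/
theorem measure_exists_stitched_lt_le {Ω : Type*} [MeasurableSpace Ω] {P : Measure Ω}
    [IsProbabilityMeasure P] {X : ℕ → Ω → ℝ} {σ α : ℝ} (hσ : 1 ≤ σ)
    (hXm : ∀ k, Measurable (X k)) (hX : iIndepFun X P)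
    (hsub : ∀ k, HasSubgaussianMGF (X k) (Real.toNNReal (σ ^ 2)) P)
    (hα : 0 < α) (hα2 : α ≤ 1 / 2) :
    P {ω | ∃ m : ℕ, 1 ≤ m ∧ m * stitched σ m α < ∑ k ∈ Finset.range m, X k ω}
      ≤ ENNReal.ofReal α := by
  refine le_trans ?_ (tsum_exp_neg_epochLevel_le hα)
  have hline := fun k : ℕ => measure_exists_line_crossing_le hXm hX hsub
    (√(√2 * epochLevel α k / 2 ^ k)) (epochLevel α k)
  refine le_trans (measure_mono ?_) ((measure_iUnion_le _).trans (ENNReal.tsum_le_tsum hline))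
  rintro ω ⟨m, hm, hlt⟩
  have hm1 : (1 : ℝ) ≤ m := by exact_mod_cast hm
  have hv : 1 ≤ m * σ ^ 2 := one_le_mul_of_one_le_of_one_le hm1 (one_le_pow₀ hσ)
  obtain ⟨k, hk1, hk2⟩ := exists_nat_pow_near hv (by norm_num : (1 : ℝ) < 2)
  refine Set.mem_iUnion.mpr ⟨k, m, hm, ?_⟩
  obtain ⟨hx, hE⟩ := epochLevel_pos_and_le hα hα2 hk1
  have hw : (0 : ℝ) < 2 ^ k := by positivity
  have hr : (2 : ℝ) ^ k * (m * σ ^ 2 / 2 ^ k) = m * σ ^ 2 := by field_simp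
  have h := line_le_of_mem_epoch (r := m * σ ^ 2 / 2 ^ k) hx ((one_le_div hw).mpr hk1)
    ((div_le_iff₀ hw).mpr (by rw [← pow_succ']; exact hk2.le)) hw rfl hE
  rw [hr, ← mul_stitched hm] at h
  rw [Real.coe_toNNReal _ (sq_nonneg σ)]
  refine le_trans (le_of_eq (by ring)) (h.trans ?_)
  exact mul_le_mul_of_nonneg_left hlt.le (Real.sqrt_nonneg _)

end Stitching

/-! ### Counting the rounds before stopping -/

section Rounds

variable {n : ℕ} {β : ℕ → ℝ → ℝ} {δ : ℝ} {x : Fin n → ℕ → ℝ}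

theorem extSub_nonneg {a b : EReal} (h : b ≤ a) : 0 ≤ extSub a b := by
  unfold extSub
  split_ifs with hab
  · exact le_rfl
  · induction b with
    | bot =>
      rw [EReal.sub_bot (ne_of_gt (lt_of_le_of_ne h (Ne.symm hab)))]
      exact le_top
    | top => exact absurd (top_le_iff.mp h) hab
    | coe b => exact (EReal.sub_nonneg (Or.inr (EReal.coe_ne_top b))
        (Or.inr (EReal.coe_ne_bot b))).mpr h

theorem eq_of_extSub_eq_zero {a b : EReal} (h : extSub a b = 0) : a = b := by
  unfold extSub at h
  split_ifs at h with hab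
  · exact hab
  · induction a <;> induction b <;> simp_all
    rw [← EReal.coe_sub, EReal.coe_eq_zero] at h
    exact hab (by linarith)

/-- If the source arm `J t` does not contribute to the interval of the challenger `C t`, then no arm
does, so that this interval is a point, and `U(C) = L(C) ≤ L(B)`. -/
theorem stops_of_len_eq_zero {A' : Type*} {f : A' → Fin n → ℝ → EReal} {R : Run A' n}
    (hR : IsRun f β δ x R) {t : ℕ} (ht : 1 ≤ t) (hne : ∀ i, (srcCI β δ x R i t).Nonempty)
    (hJ : len f β δ x R (R.J t) (R.C t) t = 0) :
    Stops f β 0 δ x R t := by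
  have hle : ∀ i a, ⨅ m ∈ srcCI β δ x R i t, f a i m ≤ ⨆ m ∈ srcCI β δ x R i t, f a i m := by
    intro i a
    obtain ⟨m, hm⟩ := hne i
    exact (iInf₂_le m hm).trans (le_iSup₂ (f := fun m _ => f a i m) m hm)
  have hsettled : ∀ a, (∀ i, len f β δ x R i a t ≤ 0) →
      tgtUCB f β δ x R a t = tgtLCB f β δ x R a t := fun a ha =>
    Finset.sum_congr rfl fun i _ =>
      eq_of_extSub_eq_zero (le_antisymm (ha i) (extSub_nonneg (hle i a)))
  unfold Stops
  rw [hsettled (R.C t) fun i => hJ ▸ hR.argmax_J t ht i, EReal.coe_zero, add_zero]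
  exact hR.argmax_B t ht _

theorem mem_iff_of_edist_lt_gap {A : Set ℝ} {m₀ m : ℝ} (h : edist m₀ m < gap A m₀) :
    m ∈ A ↔ m₀ ∈ A := by
  unfold gap at h
  split_ifs at h with h₀
  · refine iff_of_true ?_ h₀
    by_contra hm
    exact absurd (Metric.infEDist_le_edist_of_mem (x := m₀) (show m ∈ Aᶜ from hm)) (not_le.mpr h)
  · exact iff_of_false (fun hm =>
      absurd (Metric.infEDist_le_edist_of_mem (x := m₀) hm) (not_le.mpr h)) h₀

/-- The running intervals are contained in the current one, of length `2 * β`. -/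
theorem edist_le_of_mem_srcCI {A' : Type*} {R : Run A' n} {i : Fin n} {t : ℕ} (ht : 1 ≤ t)
    {m₀ m : ℝ} (h₀ : m₀ ∈ srcCI β δ x R i t) (hm : m ∈ srcCI β δ x R i t) :
    edist m₀ m ≤ ENNReal.ofReal (2 * β (pulls R i t) (δ / (2 * n))) := by
  obtain ⟨t, rfl⟩ : ∃ j, t = j + 1 := ⟨t - 1, by omega⟩
  obtain ⟨h1, h2⟩ := h₀
  obtain ⟨h3, h4⟩ := hm
  have e1 := EReal.coe_le_coe_iff.mp ((le_max_right _ _).trans h1)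
  have e2 := EReal.coe_le_coe_iff.mp (h2.trans (min_le_right _ _))
  have e3 := EReal.coe_le_coe_iff.mp ((le_max_right _ _).trans h3)
  have e4 := EReal.coe_le_coe_iff.mp (h4.trans (min_le_right _ _))
  rw [edist_dist, Real.dist_eq]
  exact ENNReal.ofReal_le_ofReal (abs_le.mpr ⟨by linarith, by linarith⟩)

theorem propInd_congr {A : Set ℝ} {m m' : ℝ} (h : m ∈ A ↔ m' ∈ A) :
    propInd A m = propInd A m' := by
  unfold propInd
  by_cases hm : m ∈ A
  · rw [if_pos hm, if_pos (h.mp hm)]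
  · rw [if_neg hm, if_neg fun hm' => hm (h.mpr hm')]

/-- A source arm contributes only as long as its confidence interval, which contains the mean, may
reach across the boundary of the property. -/
theorem gap_le_of_len_ne_zero {A : Fin n → Set ℝ} {R : Run (Finset (Fin n)) n} {i : Fin n}
    {M : Finset (Fin n)} {t : ℕ} (ht : 1 ≤ t) {m₀ : ℝ} (h₀ : m₀ ∈ srcCI β δ x R i t)
    (hlen : len (propTransfer A) β δ x R i M t ≠ 0) :
    gap (A i) m₀ ≤ ENNReal.ofReal (2 * β (pulls R i t) (δ / (2 * n))) := by
  by_contra! hlt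
  refine hlen ?_
  have hconst : ∀ m ∈ srcCI β δ x R i t, propTransfer A M i m = propTransfer A M i m₀ := by
    intro m hm
    have hiff := mem_iff_of_edist_lt_gap ((edist_le_of_mem_srcCI ht h₀ hm).trans_lt hlt)
    rw [propTransfer, propTransfer, propInd_congr hiff]
  unfold len extSub
  rw [if_pos]
  rw [biSup_congr hconst, biInf_congr hconst, biSup_const ⟨m₀, h₀⟩, biInf_const ⟨m₀, h₀⟩]

theorem one_le_pulls {A' : Type*} (R : Run A' n) (i : Fin n) (t : ℕ) : 1 ≤ pulls R i t :=
  Nat.le_add_right _ _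

theorem pulls_lt_pulls {A' : Type*} (R : Run A' n) {i : Fin n} {s t : ℕ} (hs : 1 ≤ s)
    (hst : s < t) (hi : R.J s = i) : pulls R i s < pulls R i t := by
  unfold pulls
  rw [← Finset.sum_Ico_consecutive _ hs hst.le, Finset.sum_eq_sum_Ico_succ_bot hst]
  simp only [hi, if_true]
  omega

/-- Each round is charged to its source arm `J t`, the number of samples of which it increases; hence
the rounds charged to `i` have distinct values of `pulls R i` in `[1, s i]`. -/
theorem card_rounds_le {A' : Type*} (R : Run A' n) {T : ℕ} {s : Fin n → ℝ} (hs : ∀ i, 0 ≤ s i)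
    (h : ∀ t, 1 ≤ t → t ≤ T → (pulls R (R.J t) t : ℝ) ≤ s (R.J t)) :
    (T : ℝ) ≤ ∑ i, s i := by
  have hcard : ∀ i, ((Finset.Icc 1 T).filter fun t => R.J t = i).card ≤ ⌊s i⌋₊ := by
    intro i
    rw [← Nat.add_sub_cancel ⌊s i⌋₊ 1, ← Nat.card_Icc]
    refine Finset.card_le_card_of_injOn (fun t => pulls R i t) ?_ ?_
    · intro t ht
      obtain ⟨htT, rfl⟩ := Finset.mem_filter.mp (Finset.mem_coe.mp ht)
      obtain ⟨ht1, htT⟩ := Finset.mem_Icc.mp htT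
      exact Finset.mem_coe.mpr
        (Finset.mem_Icc.mpr ⟨one_le_pulls R _ t, Nat.le_floor (h t ht1 htT)⟩)
    · intro t ht u hu htu
      obtain ⟨ht, hti⟩ := Finset.mem_filter.mp (Finset.mem_coe.mp ht)
      obtain ⟨hu, hui⟩ := Finset.mem_filter.mp (Finset.mem_coe.mp hu)
      rcases lt_trichotomy t u with hlt | heq | hlt
      · exact absurd htu (pulls_lt_pulls R (Finset.mem_Icc.mp ht).1 hlt hti).ne
      · exact heq
      · exact absurd htu (pulls_lt_pulls R (Finset.mem_Icc.mp hu).1 hlt hui).ne'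
  have hsum := Finset.card_eq_sum_card_fiberwise (s := Finset.Icc 1 T) (t := Finset.univ)
    (f := R.J) fun _ _ => Finset.mem_coe.mpr (Finset.mem_univ _)
  rw [Nat.card_Icc, Nat.add_sub_cancel] at hsum
  calc (T : ℝ) = ∑ i, (((Finset.Icc 1 T).filter fun t => R.J t = i).card : ℝ) := by
        exact_mod_cast hsum
    _ ≤ ∑ i, s i := Finset.sum_le_sum fun i _ =>
        (Nat.cast_le.mpr (hcard i)).trans (Nat.floor_le (hs i))

/-- On the event of coverage, if `s i` bounds the numbers of samples of arm `i` for which its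
confidence width does not yet resolve the gap, the algorithm stops by round `1 + ∑ i, s i`. -/
theorem stoppingTime_le_of_coverage {A : Fin n → Set ℝ} {μ : Fin n → ℝ}
    {R : Run (Finset (Fin n)) n} (hR : IsRun (propTransfer A) β δ x R)
    (hcov : ∀ t, 1 ≤ t → ∀ i, μ i ∈ srcCI β δ x R i t) {s : Fin n → ℝ} (hs0 : ∀ i, 0 ≤ s i)
    (hs : ∀ i (N : ℕ), 1 ≤ N → gap (A i) (μ i) ≤ ENNReal.ofReal (2 * β N (δ / (2 * n))) →
      (N : ℝ) ≤ s i) :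
    ((stoppingTime (propTransfer A) β 0 δ x R : ℕ∞) : ℝ≥0∞) ≤ ENNReal.ofReal (1 + ∑ i, s i) := by
  have hsum0 : 0 ≤ ∑ i, s i := Finset.sum_nonneg fun i _ => hs0 i
  by_contra! hlt
  have hgo : ∀ t, 1 ≤ t → t ≤ ⌊1 + ∑ i, s i⌋₊ → ¬ Stops (propTransfer A) β 0 δ x R t := by
    intro t ht htT hts
    have h1 : stoppingTime (propTransfer A) β 0 δ x R ≤ (t : ℕ∞) := iInf₂_le t ⟨ht, hts⟩
    have h2 : ((stoppingTime (propTransfer A) β 0 δ x R : ℕ∞) : ℝ≥0∞) ≤ (t : ℝ≥0∞) := by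
      exact_mod_cast ENat.toENNReal_le.mpr h1
    refine absurd (h2.trans ?_) (not_le.mpr hlt)
    rw [← ENNReal.ofReal_natCast]
    exact ENNReal.ofReal_le_ofReal ((Nat.cast_le.mpr htT).trans (Nat.floor_le (by linarith)))
  have hrounds := card_rounds_le R (T := ⌊1 + ∑ i, s i⌋₊) hs0 fun t ht htT => by
    have hne : ∀ i, (srcCI β δ x R i t).Nonempty := fun i => ⟨μ i, hcov t ht i⟩
    refine hs _ _ (one_le_pulls R _ t) ?_
    exact gap_le_of_len_ne_zero ht (hcov t ht _) fun hJ =>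
      hgo t ht htT (stops_of_len_eq_zero hR ht hne hJ)
  have := Nat.lt_floor_add_one (1 + ∑ i, s i)
  linarith

end Rounds

/-! ### Inverting the iterated logarithm -/

section Inversion

theorem one_le_log_exp_one_add {y : ℝ} (hy : 0 ≤ y) : 1 ≤ Real.log (Real.exp 1 + y) := by
  rw [Real.le_log_iff_exp_le (by positivity)]
  linarith

theorem loglog_nonneg {y : ℝ} (hy : 0 ≤ y) : 0 ≤ Real.log (Real.log (Real.exp 1 + y)) :=
  Real.log_nonneg (one_le_log_exp_one_add hy)

theorem loglog_mono {y z : ℝ} (hy : 0 ≤ y) (h : y ≤ z) :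
    Real.log (Real.log (Real.exp 1 + y)) ≤ Real.log (Real.log (Real.exp 1 + z)) :=
  Real.log_le_log (by linarith [one_le_log_exp_one_add hy])
    (Real.log_le_log (by positivity) (by linarith))

theorem loglog_mul_le {a b : ℝ} (ha : 0 ≤ a) (hb : 0 ≤ b) :
    Real.log (Real.log (Real.exp 1 + a * b)) ≤ Real.log 2 +
      Real.log (Real.log (Real.exp 1 + a)) + Real.log (Real.log (Real.exp 1 + b)) := by
  have h1 := one_le_log_exp_one_add ha
  have h2 := one_le_log_exp_one_add hb
  have he : 1 ≤ Real.exp 1 := Real.one_le_exp (by norm_num)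
  rw [← Real.log_mul (by norm_num) (by linarith), ← Real.log_mul (by positivity) (by linarith)]
  refine Real.log_le_log (by linarith [one_le_log_exp_one_add (mul_nonneg ha hb)]) ?_
  have h3 : Real.log (Real.exp 1 + a * b) ≤
      Real.log (Real.exp 1 + a) + Real.log (Real.exp 1 + b) := by
    rw [← Real.log_mul (by positivity) (by positivity)]
    refine Real.log_le_log (by positivity) ?_
    nlinarith [mul_nonneg ha (by linarith : 0 ≤ Real.exp 1),
      mul_nonneg hb (by linarith : 0 ≤ Real.exp 1), mul_nonneg ha hb]
  nlinarith [mul_nonneg (sub_nonneg.mpr h1) (sub_nonneg.mpr h2)]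

/-- The additive constant depends only on the slope `e`, which can be arbitrarily small. -/
theorem loglog_le_mul_add {e z : ℝ} (he : 0 < e) (hz : 0 ≤ z) :
    Real.log (Real.log (Real.exp 1 + z)) ≤ e * z + (e * Real.exp 1 + |Real.log e|) := by
  have hz' : 0 < Real.exp 1 + z := by positivity
  have h1 := Real.log_le_sub_one_of_pos (by linarith [one_le_log_exp_one_add hz] :
    0 < Real.log (Real.exp 1 + z))
  have h2 := Real.log_le_sub_one_of_pos (mul_pos he hz')
  rw [Real.log_mul he.ne' hz'.ne'] at h2
  linarith [neg_abs_le (Real.log e)]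

/-- Removes `N` from the right-hand side of `N ≤ c * X * (log log (e + N * m) + D)`. With `z = N / X`,
the iterated logarithm of `N * m = z * (m * X)` splits into that of `m * X` and that of `z`; the
latter is absorbed into the left-hand side, up to a constant that `D ≥ log 2` dominates. -/
theorem exists_loglog_inversion {c : ℝ} (hc : 0 < c) :
    ∃ K : ℝ, 0 < K ∧ ∀ X X' m D N : ℝ, 0 < X → X ≤ X' → 1 ≤ m → Real.log 2 ≤ D → 0 ≤ N →
      N ≤ c * X * (Real.log (Real.log (Real.exp 1 + N * m)) + D) →
      N ≤ K * X * (D + Real.log (Real.log (Real.exp 1 + m * X'))) := by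
  have hl2 : 0 < Real.log 2 := Real.log_pos (by norm_num)
  -- With slope `1 / (2 * c)` the term `z` reappears with factor `1/2`.
  set b : ℝ := 1 / (2 * c) * Real.exp 1 + |Real.log (1 / (2 * c))| with hb
  have hb0 : 0 ≤ b := by positivity
  refine ⟨2 * c * (2 + b / Real.log 2), by positivity, ?_⟩
  intro X X' m D N hX hXX' hm hD hN h
  set z := N / X with hz
  have hz0 : 0 ≤ z := by positivity
  have hNz : N = z * X := by rw [hz]; field_simp
  have hmX : 0 ≤ m * X := by positivity
  have h1 : z ≤ c * (Real.log (Real.log (Real.exp 1 + N * m)) + D) := by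
    rw [hz, div_le_iff₀ hX]
    linarith
  have h2 : N * m = z * (m * X) := by rw [hNz]; ring
  have h3 := loglog_mul_le hz0 hmX
  have h4 := loglog_le_mul_add (e := 1 / (2 * c)) (by positivity) hz0
  have h5 : Real.log (Real.log (Real.exp 1 + m * X)) ≤
      Real.log (Real.log (Real.exp 1 + m * X')) :=
    loglog_mono hmX (mul_le_mul_of_nonneg_left hXX' (by linarith))
  have h6 := loglog_nonneg hmX
  rw [h2] at h1
  have h7 : z ≤ c * (1 / (2 * c) * z + b + 2 * D + Real.log (Real.log (Real.exp 1 + m * X'))) :=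
    h1.trans (mul_le_mul_of_nonneg_left (by linarith) hc.le)
  have h8 : c * (1 / (2 * c) * z) = z / 2 := by field_simp
  have h9 : b ≤ b / Real.log 2 * D := by
    rw [div_mul_eq_mul_div, le_div_iff₀ hl2]
    exact mul_le_mul_of_nonneg_left hD hb0
  have h10 : z ≤ 2 * c * (2 * D + b / Real.log 2 * D +
      Real.log (Real.log (Real.exp 1 + m * X'))) := by
    nlinarith [mul_le_mul_of_nonneg_left h9 hc.le]
  have h11 : 2 * D + b / Real.log 2 * D + Real.log (Real.log (Real.exp 1 + m * X')) ≤
      (2 + b / Real.log 2) * (D + Real.log (Real.log (Real.exp 1 + m * X'))) := by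
    have : 0 ≤ b / Real.log 2 := by positivity
    nlinarith [mul_nonneg this (h6.trans h5)]
  rw [hNz]
  have h12 := h10.trans (mul_le_mul_of_nonneg_left h11 (by positivity))
  nlinarith [mul_le_mul_of_nonneg_right h12 hX.le]

end Inversion

/-! ### The bound on the event of coverage -/

section Complexity

variable {n : ℕ}

/-- Continuity of the transfer function at the mean excludes means on the boundary of the property. -/
theorem gap_ne_zero_of_continuousAt {A : Fin n → Set ℝ} {i : Fin n} {m₀ : ℝ}
    (h : ContinuousAt (propTransfer A {i} i) m₀) : gap (A i) m₀ ≠ 0 := by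
  have hval : ∀ m, propTransfer A {i} i m = propInd (A i) m := fun m => by simp [propTransfer]
  unfold gap
  split_ifs with h₀
  · have hev : ∀ᶠ m in nhds m₀, (0 : EReal) < propTransfer A {i} i m := by
      refine h.eventually (lt_mem_nhds ?_)
      rw [hval, propInd, if_pos h₀]
      exact zero_lt_one
    refine (Metric.infEDist_pos_iff_notMem_closure.mpr fun hcl => ?_).ne'
    obtain ⟨m, hm, hpos⟩ := ((mem_closure_iff_frequently.mp hcl).and_eventually hev).exists
    rw [hval, propInd, if_neg hm] at hpos
    exact not_lt_bot hpos
  · have hev : ∀ᶠ m in nhds m₀, propTransfer A {i} i m < (1 : EReal) := by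
      refine h.eventually (gt_mem_nhds ?_)
      rw [hval, propInd, if_neg h₀]
      exact EReal.bot_lt_coe 1
    refine (Metric.infEDist_pos_iff_notMem_closure.mpr fun hcl => ?_).ne'
    obtain ⟨m, hm, hlt⟩ := ((mem_closure_iff_frequently.mp hcl).and_eventually hev).exists
    rw [hval, propInd, if_pos hm] at hlt
    exact lt_irrefl _ hlt

theorem two_div_sq_gap_ne_top {A : Set ℝ} {m : ℝ} (h : gap A m ≠ 0) : 2 / gap A m ^ 2 ≠ ⊤ :=
  ENNReal.div_ne_top (by norm_num) (pow_ne_zero 2 h)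

theorem toReal_complexity {A : Fin n → Set ℝ} {μ : Fin n → ℝ} (h : ∀ i, gap (A i) (μ i) ≠ 0) :
    (complexity A μ).toReal = ∑ i, (2 / gap (A i) (μ i) ^ 2).toReal :=
  ENNReal.toReal_sum fun i _ => two_div_sq_gap_ne_top (h i)

/-- The bound on the stopping time as a statement about one trajectory: it holds whenever all
confidence intervals contain the means. -/
theorem exists_stoppingTime_le_timeBound {c : ℝ} (hc : 0 < c) :
    ∃ K : ℝ, 0 < K ∧ ∀ (n : ℕ), 1 ≤ n → ∀ (σ δ : ℝ), 0 < σ → 0 < δ → δ < 1 →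
      ∀ (A : Fin n → Set ℝ) (μ : Fin n → ℝ), (∀ i, gap (A i) (μ i) ≠ 0) →
      ∀ (β : ℕ → ℝ → ℝ),
        (∀ s : ℕ, 1 ≤ s → β s (δ / (2 * n)) ≤
          c * √(σ ^ 2 * (Real.log (Real.log (Real.exp 1 + s * max 1 (σ ^ 2)))
            + Real.log (2 * n / δ)) / s)) →
      ∀ (x : Fin n → ℕ → ℝ) (R : Run (Finset (Fin n)) n), IsRun (propTransfer A) β δ x R →
        (∀ t, 1 ≤ t → ∀ i, μ i ∈ srcCI β δ x R i t) →
        ((stoppingTime (propTransfer A) β 0 δ x R : ℕ∞) : ℝ≥0∞) ≤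
          ENNReal.ofReal (timeBound K n σ δ (complexity A μ).toReal) := by
  obtain ⟨K, hK, hinv⟩ := exists_loglog_inversion (c := 2 * c ^ 2) (by positivity)
  refine ⟨K, hK, ?_⟩
  intro n hn σ δ hσ hδ hδ1 A μ hgap β hβ x R hR hcov
  have hn1 : (1 : ℝ) ≤ n := by exact_mod_cast hn
  set m := max 1 (σ ^ 2)
  have hm : 1 ≤ m := le_max_left _ _
  set h : Fin n → ℝ := fun i => (2 / gap (A i) (μ i) ^ 2).toReal with hh
  set H := (complexity A μ).toReal with hH
  have hHsum : H = ∑ i, h i := toReal_complexity hgap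
  have hh0 : ∀ i, 0 ≤ h i := fun i => ENNReal.toReal_nonneg
  have hH0 : 0 ≤ H := ENNReal.toReal_nonneg
  set D := Real.log (2 * n / δ) with hDdef
  have hD : Real.log 2 ≤ D := Real.log_le_log (by norm_num) (by
    rw [le_div_iff₀ hδ]
    nlinarith)
  have hD0 : 0 ≤ D := (Real.log_nonneg (by norm_num)).trans hD
  have hDsplit : Real.log (1 / δ) + Real.log (2 * n) = D := by
    rw [← Real.log_mul (by positivity) (by positivity), hDdef]
    congr 1
    ring
  set E := D + Real.log (Real.log (Real.exp 1 + m * (σ ^ 2 * H))) with hE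
  have hE0 : 0 ≤ E := add_nonneg hD0 (loglog_nonneg (by positivity))
  have htime : timeBound K n σ δ H = 1 + ∑ i, K * (σ ^ 2 * h i) * E := by
    rw [timeBound, hDsplit, ← Finset.sum_mul, ← Finset.mul_sum, ← Finset.mul_sum, ← hHsum, hE,
      mul_assoc m]
    ring
  rw [htime]
  refine stoppingTime_le_of_coverage hR hcov
    (fun i => mul_nonneg (mul_nonneg hK.le (mul_nonneg (sq_nonneg σ) (hh0 i))) hE0) ?_
  intro i N hN hle
  have hN0 : (0 : ℝ) < N := by exact_mod_cast hN
  -- An arm of infinite gap is never unresolved, which matches its contribution `2 / ⊤ = 0`.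
  have htop : gap (A i) (μ i) ≠ ⊤ := ne_top_of_le_ne_top ENNReal.ofReal_ne_top hle
  set g := (gap (A i) (μ i)).toReal with hg
  have hg0 : 0 < g := ENNReal.toReal_pos (hgap i) htop
  have hhi : h i = 2 / g ^ 2 := by
    simp only [hh, ENNReal.toReal_div, ENNReal.toReal_pow, ENNReal.toReal_ofNat, hg]
  set ℓ := Real.log (Real.log (Real.exp 1 + N * m)) with hℓ
  have hℓ0 : 0 ≤ ℓ := loglog_nonneg (by positivity)
  have hgβ : g ≤ 2 * β N (δ / (2 * n)) := by
    have h1 := hle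
    rw [← ENNReal.ofReal_toReal htop] at h1
    by_contra! hlt
    exact absurd h1 (not_le.mpr ((ENNReal.ofReal_lt_ofReal_iff hg0).mpr hlt))
  have hgsq : g ^ 2 ≤ 4 * c ^ 2 * (σ ^ 2 * (ℓ + D) / N) := by
    have h1 : g ≤ 2 * c * √(σ ^ 2 * (ℓ + D) / N) := by linarith [hβ N hN]
    have h2 := pow_le_pow_left₀ hg0.le h1 2
    rw [mul_pow, Real.sq_sqrt (by positivity)] at h2
    linarith
  refine hinv (σ ^ 2 * h i) (σ ^ 2 * H) m D N ?_ ?_ hm hD hN0.le ?_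
  · rw [hhi]; positivity
  · rw [hHsum]
    exact mul_le_mul_of_nonneg_left
      (Finset.single_le_sum (fun j _ => hh0 j) (Finset.mem_univ i)) (sq_nonneg σ)
  · rw [hhi]
    have h1 : g ^ 2 * N ≤ 4 * c ^ 2 * (σ ^ 2 * (ℓ + D)) := by
      have h2 := mul_le_mul_of_nonneg_right hgsq hN0.le
      have h3 : 4 * c ^ 2 * (σ ^ 2 * (ℓ + D) / N) * N = 4 * c ^ 2 * (σ ^ 2 * (ℓ + D)) := by
        field_simp
      rwa [h3] at h2
    have h4 : 2 * c ^ 2 * (σ ^ 2 * (2 / g ^ 2)) * (ℓ + D) =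
        4 * c ^ 2 * (σ ^ 2 * (ℓ + D)) / g ^ 2 := by ring
    rw [h4, le_div_iff₀ (by positivity)]
    linarith

end Complexity

/-! ### Coverage of the stitched confidence sequences -/

section Coverage

variable {n : ℕ}

/-- The stitched boundary is of the order required in `exists_stoppingTime_le_timeBound`. -/
theorem stitched_le {n : ℕ} (hn : 1 ≤ n) {σ δ : ℝ} (hσ : 1 ≤ σ) (hδ : 0 < δ) (hδ1 : δ < 1)
    {s : ℕ} (hs : 1 ≤ s) :
    stitched σ s (δ / (2 * n)) ≤
      4 * √(σ ^ 2 * (Real.log (Real.log (Real.exp 1 + s * max 1 (σ ^ 2)))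
        + Real.log (2 * n / δ)) / s) := by
  have hn1 : (1 : ℝ) ≤ n := by exact_mod_cast hn
  have hs1 : (1 : ℝ) ≤ s := by exact_mod_cast hs
  have hs0 : (0 : ℝ) < s := by linarith
  have hσ2 : 1 ≤ σ ^ 2 := one_le_pow₀ hσ
  have hl2 : 0 < Real.log 2 := Real.log_pos (by norm_num)
  have hv : 1 ≤ s * σ ^ 2 := one_le_mul_of_one_le_of_one_le hs1 hσ2
  rw [max_eq_right hσ2]
  have hD : Real.log 2 ≤ Real.log (2 * n / δ) := Real.log_le_log (by norm_num) (by
    rw [le_div_iff₀ hδ]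
    nlinarith)
  have hD' : Real.log (5.2 / (δ / (2 * n))) ≤ 4 * Real.log (2 * n / δ) := by
    have h1 : (5.2 : ℝ) / (δ / (2 * n)) = 5.2 * (2 * n / δ) := by field_simp
    have h2 : Real.log 5.2 ≤ Real.log ((2 : ℝ) ^ 3) :=
      Real.log_le_log (by norm_num) (by norm_num)
    rw [Real.log_pow] at h2
    push_cast at h2
    rw [h1, Real.log_mul (by norm_num) (by positivity)]
    linarith
  have hll : Real.log (Real.log (2 * s * σ ^ 2)) ≤
      Real.log 2 + Real.log (Real.log (Real.exp 1 + s * σ ^ 2)) := by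
    have h1 := one_le_log_exp_one_add (by positivity : 0 ≤ s * σ ^ 2)
    rw [← Real.log_mul (by norm_num) (by linarith)]
    refine Real.log_le_log (Real.log_pos (by linarith)) ?_
    have h2 : Real.log (2 * s * σ ^ 2) ≤ Real.log (2 * (Real.exp 1 + s * σ ^ 2)) :=
      Real.log_le_log (by positivity) (by linarith [Real.exp_pos 1])
    rw [Real.log_mul (by norm_num) (by positivity :
      Real.exp 1 + s * σ ^ 2 ≠ 0)] at h2
    have h3 : Real.log 2 ≤ 1 := by linarith [Real.log_two_lt_d9]
    linarith
  have hℓ := loglog_nonneg (by positivity : 0 ≤ s * σ ^ 2)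
  have h17 : (1.7 : ℝ) = √(1.7 ^ 2) := (Real.sqrt_sq (by norm_num)).symm
  have h4 : (4 : ℝ) = √(4 ^ 2) := (Real.sqrt_sq (by norm_num)).symm
  rw [stitched, h17, h4, ← Real.sqrt_mul (by norm_num), ← Real.sqrt_mul (by norm_num)]
  refine Real.sqrt_le_sqrt ?_
  rw [← mul_div_assoc, ← mul_div_assoc, div_le_div_iff_of_pos_right hs0, mul_left_comm,
    mul_left_comm _ (σ ^ 2)]
  refine mul_le_mul_of_nonneg_left ?_ (sq_nonneg σ)
  linarith

theorem mem_srcCI_of_forall {A' : Type*} {β : ℕ → ℝ → ℝ} {δ : ℝ} {x : Fin n → ℕ → ℝ}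
    {R : Run A' n} {i : Fin n} {μ : ℝ}
    (hup : ∀ m : ℕ, 1 ≤ m →
      ∑ k ∈ Finset.range m, (x i k - μ) ≤ m * β m (δ / (2 * n)))
    (hlo : ∀ m : ℕ, 1 ≤ m →
      ∑ k ∈ Finset.range m, (-(x i k - μ)) ≤ m * β m (δ / (2 * n))) (t : ℕ) :
    μ ∈ srcCI β δ x R i t := by
  induction t with
  | zero => exact ⟨bot_le, le_top⟩
  | succ t ih =>
    have hN := one_le_pulls R i (t + 1)
    have hN0 : (0 : ℝ) < pulls R i (t + 1) := by exact_mod_cast hN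
    have h1 := hup _ hN
    have h2 := hlo _ hN
    rw [Finset.sum_neg_distrib] at h2
    rw [Finset.sum_sub_distrib, Finset.sum_const, Finset.card_range, nsmul_eq_mul] at h1 h2
    have hmean : (pulls R i (t + 1) : ℝ) * empMean x R i (t + 1) =
        ∑ k ∈ Finset.range (pulls R i (t + 1)), x i k := by
      rw [empMean]; field_simp
    rw [← hmean] at h1 h2
    refine ⟨max_le ih.1 (EReal.coe_le_coe_iff.mpr ?_), le_min ih.2 (EReal.coe_le_coe_iff.mpr ?_)⟩
    · refine le_of_mul_le_mul_left ?_ hN0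
      linarith
    · refine le_of_mul_le_mul_left ?_ hN0
      linarith

/-- Two-sided coverage of all arms. The failure event is contained in an event that concerns all
numbers of samples and not the run, so that nothing is assumed about the dependence of the choices
on the samples (not even measurability). -/
theorem measure_not_coverage_stitched_le (hn : 1 ≤ n) {σ δ : ℝ} (hσ : 1 ≤ σ) (hδ : 0 < δ)
    (hδ1 : δ < 1) {S : Fin n → Measure ℝ} (hS : IsSubGaussianBandit S σ)
    {Ω : Type*} [MeasurableSpace Ω] {P : Measure Ω} [IsProbabilityMeasure P]
    {Y : Fin n → ℕ → Ω → ℝ} (hY : IsSampling S P Y) {A' : Type*} (R : Ω → Run A' n) :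
    P {ω | ∃ t, 1 ≤ t ∧ ∃ i,
        armMean S i ∉ srcCI (stitched σ) δ (fun i k => Y i k ω) (R ω) i t}
      ≤ ENNReal.ofReal δ := by
  have hn1 : (1 : ℝ) ≤ n := by exact_mod_cast hn
  set α := δ / (2 * n) with hα
  have hα0 : 0 < α := by positivity
  have hα2 : α ≤ 1 / 2 := by
    rw [hα, div_le_iff₀ (by positivity)]
    linarith
  set X : Fin n → ℕ → Ω → ℝ := fun i k ω => Y i k ω - armMean S i with hX
  have hXm : ∀ i k, Measurable (X i k) := fun i k => (hY.measurable i k).sub_const _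
  have hXind : ∀ i, iIndepFun (X i) P := fun i =>
    (hY.indep.precomp (g := fun k => (i, k)) fun _ _ h => (Prod.mk.inj h).2).comp
      (fun _ y => y - armMean S i) fun _ => by fun_prop
  have hXsub : ∀ i k, HasSubgaussianMGF (X i k) (Real.toNNReal (σ ^ 2)) P := fun i k => by
    have h := hS.subGaussian i
    rw [← hY.law i k] at h
    exact HasSubgaussianMGF.of_map (hY.measurable i k).aemeasurable h
  set U : Fin n → Set Ω := fun i =>
    {ω | ∃ m : ℕ, 1 ≤ m ∧ m * stitched σ m α < ∑ k ∈ Finset.range m, X i k ω} with hU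
  set L : Fin n → Set Ω := fun i =>
    {ω | ∃ m : ℕ, 1 ≤ m ∧ m * stitched σ m α < ∑ k ∈ Finset.range m, (-X i k) ω} with hL
  have hUP : ∀ i, P (U i) ≤ ENNReal.ofReal α := fun i =>
    measure_exists_stitched_lt_le hσ (hXm i) (hXind i) (hXsub i) hα0 hα2
  have hLP : ∀ i, P (L i) ≤ ENNReal.ofReal α := fun i =>
    measure_exists_stitched_lt_le hσ (fun k => (hXm i k).neg)
      ((hXind i).comp (fun _ y => -y) fun _ => by fun_prop) (fun k => (hXsub i k).neg) hα0 hα2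
  calc _ ≤ P (⋃ i, (U i ∪ L i)) := by
        refine measure_mono ?_
        rintro ω ⟨t, -, i, hi⟩
        refine Set.mem_iUnion.mpr ⟨i, ?_⟩
        by_contra hnot
        refine hi (mem_srcCI_of_forall ?_ ?_ t)
        · intro m hm
          by_contra! hlt
          exact hnot (Or.inl ⟨m, hm, hlt⟩)
        · intro m hm
          by_contra! hlt
          exact hnot (Or.inr ⟨m, hm, hlt⟩)
    _ ≤ ∑ i, P (U i ∪ L i) := measure_iUnion_fintype_le _ _
    _ ≤ ∑ _i : Fin n, (ENNReal.ofReal α + ENNReal.ofReal α) :=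
        Finset.sum_le_sum fun i _ => (measure_union_le _ _).trans (add_le_add (hUP i) (hLP i))
    _ = ENNReal.ofReal δ := by
        rw [Finset.sum_const, Finset.card_univ, Fintype.card_fin, nsmul_eq_mul,
          ← ENNReal.ofReal_add hα0.le hα0.le, ← ENNReal.ofReal_natCast,
          ← ENNReal.ofReal_mul (by positivity), hα]
        congr 1
        field_simp
        ring

end Coverage

/-! ### Property testing with the stitched boundary -/

section StitchedPropertyTesting

theorem exists_stoppingTime_stitched_le_timeBound :
    ∃ K : ℝ, 0 < K ∧
      ∀ (n : ℕ), 1 ≤ n → ∀ (σ δ : ℝ), 1 ≤ σ → 0 < δ → δ < 1 →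
      ∀ (S : Fin n → Measure ℝ), IsSubGaussianBandit S σ →
      ∀ (A : Fin n → Set ℝ),
        (∀ M i, ContinuousAt (propTransfer A M i) (armMean S i)) →
      ∀ (Ω : Type*) [MeasurableSpace Ω] (P : Measure Ω) [IsProbabilityMeasure P]
        (Y : Fin n → ℕ → Ω → ℝ), IsSampling S P Y →
      ∀ (R : Ω → Run (Finset (Fin n)) n),
        (∀ ω, IsRun (propTransfer A) (stitched σ) δ
          (fun i k => Y i k ω) (R ω)) →
        P {ω | ENNReal.ofReal
              (timeBound K n σ δ (complexity A (armMean S)).toReal)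
            < ((stoppingTime (propTransfer A) (stitched σ) 0 δ
                (fun i k => Y i k ω) (R ω) : ℕ∞) : ℝ≥0∞)}
          ≤ ENNReal.ofReal δ := by
  obtain ⟨K, hK, h⟩ := exists_stoppingTime_le_timeBound (c := 4) (by norm_num)
  refine ⟨K, hK, ?_⟩
  intro n hn σ δ hσ hδ hδ1 S hS A hA Ω _ P _ Y hY R hR
  refine (measure_mono fun ω hω => ?_).trans
    (measure_not_coverage_stitched_le hn hσ hδ hδ1 hS hY R)
  by_contra hcov
  simp only [Set.mem_ofPred_eq, not_exists, not_and, not_not] at hcov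
  exact absurd (h n hn σ δ (by linarith) hδ hδ1 A _
    (fun i => gap_ne_zero_of_continuousAt (hA {i} i)) _
    (fun s hs => stitched_le hn hσ hδ hδ1 hs) _ _ (hR ω) hcov) (not_le.mpr hω)

end StitchedPropertyTesting

/-! ### Thresholding bandits -/

section Thresholding

/-- On the threshold itself both sides vanish. -/
theorem gap_Ioi {θ m : ℝ} : gap (Set.Ioi θ) m = ENNReal.ofReal |m - θ| := by
  rw [← Real.dist_eq, ← edist_dist]
  unfold gap
  split_ifs with h
  · rw [Set.compl_Ioi]
    refine le_antisymm (Metric.infEDist_le_edist_of_mem Set.self_mem_Iic)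
      (Metric.le_infEDist.mpr fun y hy => ?_)
    rw [edist_dist, edist_dist, Real.dist_eq, Real.dist_eq]
    refine ENNReal.ofReal_le_ofReal ?_
    have h1 : θ < m := h
    have h2 : y ≤ θ := hy
    rw [abs_of_pos (by linarith), abs_of_pos (by linarith)]
    linarith
  · rw [← Metric.infEDist_closure, closure_Ioi]
    refine le_antisymm (Metric.infEDist_le_edist_of_mem Set.self_mem_Ici)
      (Metric.le_infEDist.mpr fun y hy => ?_)
    rw [edist_dist, edist_dist, Real.dist_eq, Real.dist_eq]
    refine ENNReal.ofReal_le_ofReal ?_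
    have h1 : m ≤ θ := not_lt.mp h
    have h2 : θ ≤ y := hy
    rw [abs_of_nonpos (by linarith), abs_of_nonpos (by linarith)]
    linarith

theorem toReal_complexity_Ioi {n : ℕ} {θ : ℝ} {μ : Fin n → ℝ} (h : ∀ i, μ i ≠ θ) :
    (complexity (fun _ => Set.Ioi θ) μ).toReal = ∑ i, 2 / (μ i - θ) ^ 2 := by
  rw [toReal_complexity fun i => by
    rw [gap_Ioi]
    exact (ENNReal.ofReal_pos.mpr (abs_pos.mpr (sub_ne_zero.mpr (h i)))).ne']
  refine Finset.sum_congr rfl fun i _ => ?_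
  rw [gap_Ioi, ENNReal.toReal_div, ENNReal.toReal_pow, ENNReal.toReal_ofReal (abs_nonneg _),
    sq_abs, ENNReal.toReal_ofNat]

theorem continuousAt_propTransfer_Ioi {n : ℕ} {θ m : ℝ} (h : m ≠ θ) (M : Finset (Fin n))
    (i : Fin n) : ContinuousAt (propTransfer (fun _ => Set.Ioi θ) M i) m := by
  have hev : ∀ᶠ y in nhds m, (y ∈ Set.Ioi θ ↔ m ∈ Set.Ioi θ) := by
    rcases lt_or_gt_of_ne h with h | h
    · filter_upwards [gt_mem_nhds h] with y hy
      exact iff_of_false (not_lt.mpr hy.le) (not_lt.mpr h.le)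
    · filter_upwards [lt_mem_nhds h] with y hy
      exact iff_of_true hy h
  refine (continuousAt_const (y := propTransfer (fun _ => Set.Ioi θ) M i m)).congr ?_
  filter_upwards [hev] with y hy
  rw [propTransfer, propTransfer, propInd_congr hy]

end Thresholding

end TLUCB

theorem corollary1 :
    -- (i) property testing with the polynomial stitched boundary
    (∃ K : ℝ, 0 < K ∧
      ∀ (n : ℕ), 1 ≤ n → ∀ (σ δ : ℝ), 1 ≤ σ → 0 < δ → δ < 1 →
      ∀ (S : Fin n → Measure ℝ), TLUCB.IsSubGaussianBandit S σ →
      ∀ (A : Fin n → Set ℝ),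
        (∀ M i, ContinuousAt (TLUCB.propTransfer A M i) (TLUCB.armMean S i)) →
      ∀ (Ω : Type*) [MeasurableSpace Ω] (P : Measure Ω) [IsProbabilityMeasure P]
        (Y : Fin n → ℕ → Ω → ℝ), TLUCB.IsSampling S P Y →
      ∀ (R : Ω → TLUCB.Run (Finset (Fin n)) n),
        (∀ ω, TLUCB.IsRun (TLUCB.propTransfer A) (TLUCB.stitched σ) δ
          (fun i k => Y i k ω) (R ω)) →
        P {ω | ENNReal.ofReal
              (TLUCB.timeBound K n σ δ (TLUCB.complexity A (TLUCB.armMean S)).toReal)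
            < ((TLUCB.stoppingTime (TLUCB.propTransfer A) (TLUCB.stitched σ) 0 δ
                (fun i k => Y i k ω) (R ω) : ℕ∞) : ℝ≥0∞)}
          ≤ ENNReal.ofReal δ)
    ∧
    -- (ii) thresholding bandits
    (∃ K : ℝ, 0 < K ∧
      ∀ (n : ℕ), 1 ≤ n → ∀ (σ δ : ℝ), 1 ≤ σ → 0 < δ → δ < 1 →
      ∀ (S : Fin n → Measure ℝ), TLUCB.IsSubGaussianBandit S σ →
      ∀ (θ : ℝ), (∀ i, TLUCB.armMean S i ≠ θ) →
      ∀ (Ω : Type*) [MeasurableSpace Ω] (P : Measure Ω) [IsProbabilityMeasure P]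
        (Y : Fin n → ℕ → Ω → ℝ), TLUCB.IsSampling S P Y →
      ∀ (R : Ω → TLUCB.Run (Finset (Fin n)) n),
        (∀ ω, TLUCB.IsRun (TLUCB.propTransfer (fun _ => Set.Ioi θ)) (TLUCB.stitched σ) δ
          (fun i k => Y i k ω) (R ω)) →
        P {ω | ENNReal.ofReal
              (TLUCB.timeBound K n σ δ (∑ i, 2 / (TLUCB.armMean S i - θ) ^ 2))
            < ((TLUCB.stoppingTime (TLUCB.propTransfer (fun _ => Set.Ioi θ))
                (TLUCB.stitched σ) 0 δ (fun i k => Y i k ω) (R ω) : ℕ∞) : ℝ≥0∞)}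
          ≤ ENNReal.ofReal δ)
    ∧
    -- (iii) property testing with any width function of this order whose confidence
    -- sequences have the required coverage
    (∀ c : ℝ, 0 < c → ∃ K : ℝ, 0 < K ∧
      ∀ (n : ℕ), 1 ≤ n → ∀ (σ δ : ℝ), 0 < σ → 0 < δ → δ < 1 →
      ∀ (S : Fin n → Measure ℝ), TLUCB.IsSubGaussianBandit S σ →
      ∀ (A : Fin n → Set ℝ),
        (∀ M i, ContinuousAt (TLUCB.propTransfer A M i) (TLUCB.armMean S i)) →
      ∀ (β : ℕ → ℝ → ℝ),
        (∀ s : ℕ, 1 ≤ s → β s (δ / (2 * n)) ≤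
          c * √(σ ^ 2 * (Real.log (Real.log (Real.exp 1 + s * max 1 (σ ^ 2)))
            + Real.log (2 * n / δ)) / s)) →
      ∀ (Ω : Type*) [MeasurableSpace Ω] (P : Measure Ω) [IsProbabilityMeasure P]
        (Y : Fin n → ℕ → Ω → ℝ), TLUCB.IsSampling S P Y →
      ∀ (R : Ω → TLUCB.Run (Finset (Fin n)) n),
        (∀ ω, TLUCB.IsRun (TLUCB.propTransfer A) β δ (fun i k => Y i k ω) (R ω)) →
        P {ω | ∃ t, 1 ≤ t ∧ ∃ i,
            TLUCB.armMean S i ∉ TLUCB.srcCI β δ (fun i k => Y i k ω) (R ω) i t}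
          ≤ ENNReal.ofReal δ →
        P {ω | ENNReal.ofReal
              (TLUCB.timeBound K n σ δ (TLUCB.complexity A (TLUCB.armMean S)).toReal)
            < ((TLUCB.stoppingTime (TLUCB.propTransfer A) β 0 δ
                (fun i k => Y i k ω) (R ω) : ℕ∞) : ℝ≥0∞)}
          ≤ ENNReal.ofReal δ) := by
  refine ⟨TLUCB.exists_stoppingTime_stitched_le_timeBound, ?_, ?_⟩
  · obtain ⟨K, hK, h⟩ := TLUCB.exists_stoppingTime_stitched_le_timeBound
    refine ⟨K, hK, ?_⟩
    intro n hn σ δ hσ hδ hδ1 S hS θ hθ Ω _ P _ Y hY R hR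
    rw [← TLUCB.toReal_complexity_Ioi hθ]
    exact h n hn σ δ hσ hδ hδ1 S hS _
      (fun M i => TLUCB.continuousAt_propTransfer_Ioi (hθ i) M i) Ω P Y hY R hR
  · intro c hc
    obtain ⟨K, hK, h⟩ := TLUCB.exists_stoppingTime_le_timeBound hc
    refine ⟨K, hK, ?_⟩
    intro n hn σ δ hσ hδ hδ1 S hS A hA β hβ Ω _ P _ Y hY R hR hcover
    refine (measure_mono fun ω hω => ?_).trans hcover
    by_contra hcov
    simp only [Set.mem_ofPred_eq, not_exists, not_and, not_not] at hcov
    exact absurd (h n hn σ δ hσ hδ hδ1 A _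
      (fun i => TLUCB.gap_ne_zero_of_continuousAt (hA {i} i)) β hβ _ _ (hR ω) hcov)
      (not_le.mpr hω)
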